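/- Let $P\subset\mathbb R^n$ be a convex polytope (the convex hull of finitely many points), with support function $\phi_P(x)=\sup_{p\in P}\langle x,p\rangle$, and let $\mathcal P$ be the class of convex functions $u:\mathbb R^n\to\mathbb R$ for which there is a constant $C$ with $u\le\phi_P+C$. For $u\in\mathcal P$ let $u^*(p)=\sup_{x\in\mathbb R^n}(\langle x,p\rangle-u(x))\in\mathbb R\cup\{+\infty\}$ be its Legendre transform. Let $g(p)\,dp$ be a probability measure on $P$ whose density satisfies $1/C<g<C$ almost everywhere on $P$ for some constant $C>0$, and let $\mu$ be any Borel probability measure on $\mathbb R^n$. Call $u\in\mathcal P$ a solution of $MA_g(u)=\mu$ if at almost every $p\in P$ the function $u^*$ is finite near $p$ and differentiable at $p$, and $$\int_{\mathbb R^n} f\,d\mu=\int_P f(\nabla u^*(p))\,g(p)\,dp$$ for every bounded continuous function $f:\mathbb R^n\to\mathbb R$. Then a solution $u\in\mathcal P$ exists, and it is unique in $\mathcal P$ up to an additive constant: if $u,v\in\mathcal P$ are solutions, then $v-u$ is constant on $\mathbb R^n$. -/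

import Mathlib

open MeasureTheory Filter Topology
open scoped BoundedContinuousFunction

noncomputable section

namespace TransportedMA

/-- A (bounded) convex polytope: the convex hull of finitely many points. -/
def IsPolytope {n : ℕ} (P : Set (EuclideanSpace ℝ (Fin n))) : Prop :=
  ∃ s : Set (EuclideanSpace ℝ (Fin n)), s.Finite ∧ P = convexHull ℝ s

/-- The support function `φ_P(x) = sup_{p ∈ P} ⟨x, p⟩` of a nonempty bounded set `P`. -/
def supportFun {n : ℕ} (P : Set (EuclideanSpace ℝ (Fin n))) (x : EuclideanSpace ℝ (Fin n)) : ℝ :=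
  sSup ((fun p => inner ℝ x p) '' P)

/-- The class of convex functions `u` on `ℝⁿ` with `u ≤ φ_P + C` for some constant `C`.
As `φ_P` is finite, such functions are real valued. -/
def ConvexClass {n : ℕ} (P : Set (EuclideanSpace ℝ (Fin n))) :
    Set (EuclideanSpace ℝ (Fin n) → ℝ) :=
  {u | ConvexOn ℝ Set.univ u ∧ ∃ C : ℝ, ∀ x, u x ≤ supportFun P x + C}

/-- The Legendre transform `u*(p) = sup_x (⟨x, p⟩ - u(x))`, which may take the value `+∞`. -/
def legendre {n : ℕ} (u : EuclideanSpace ℝ (Fin n) → ℝ) (p : EuclideanSpace ℝ (Fin n)) : EReal :=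
  ⨆ x : EuclideanSpace ℝ (Fin n), ((inner ℝ x p - u x : ℝ) : EReal)

/-- `dom(∇φ)` for an extended-real valued `φ`: the points near which `φ` is finite and at which
it is differentiable. -/
def gradDom {n : ℕ} (φ : EuclideanSpace ℝ (Fin n) → EReal) : Set (EuclideanSpace ℝ (Fin n)) :=
  {p | (∀ᶠ q in 𝓝 p, φ q ≠ ⊤ ∧ φ q ≠ ⊥) ∧ DifferentiableAt ℝ (fun q => (φ q).toReal) p}

/-- The gradient of an extended-real valued function; meaningful on `gradDom φ`. -/
def egrad {n : ℕ} (φ : EuclideanSpace ℝ (Fin n) → EReal) (p : EuclideanSpace ℝ (Fin n)) :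
    EuclideanSpace ℝ (Fin n) :=
  gradient (fun q => (φ q).toReal) p

/-- `u` is a solution of `MA_g(u) = μ` in the class of `P`: the gradient `∇u*` exists almost
everywhere on `P` and `∫ f dμ = ∫_P f(∇u*(p)) g(p) dp` for all bounded continuous `f`. -/
structure IsSolution {n : ℕ} (P : Set (EuclideanSpace ℝ (Fin n)))
    (g : EuclideanSpace ℝ (Fin n) → ℝ) (μ : Measure (EuclideanSpace ℝ (Fin n)))
    (u : EuclideanSpace ℝ (Fin n) → ℝ) : Prop where
  mem_class : u ∈ ConvexClass P
  ae_mem_gradDom : ∀ᵐ p ∂(volume.restrict P), p ∈ gradDom (legendre u)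
  integral_eq : ∀ f : EuclideanSpace ℝ (Fin n) →ᵇ ℝ,
    ∫ x, f x ∂μ = ∫ p in P, f (egrad (legendre u) p) * g p

end TransportedMA

end

/-!
Write `ν` for the probability measure `g(p) dp` on `P`. A solution is a function `u` in the class of
`P` whose transform `u*` has a gradient that carries `ν` to `μ`; no moment of `μ` is assumed.

**Uniqueness.** Let `u`, `v` be solutions and `h = v - u`. Fenchel's inequality, which is an equality
at the gradient (`apply_egrad_legendre`), gives `h(∇v*) ≤ u* - v* ≤ h(∇u*)` almost everywhere on `P`.
Both outer functions have under `ν` the law of `h` under `μ`, so integrating the bounded function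
`arctan ∘ h` shows that the inequalities are equalities. Then `∇u* p` attains the supremum that
defines `v* p`, hence `∇u* = ∇v*` almost everywhere (`egrad_legendre_ae_eq`). Convex functions with
almost everywhere equal gradients differ by a constant on the interior of `P`
(`sub_eq_sub_of_ae_hasGradientAt`), and a function of the class is recovered from its transform
there (`add_le_of_legendre_le_on_interior`), because that transform is infinite off `P`.

**Existence.** For a finitely supported target with atoms `a i`, minimising
`f ↦ ∫ f dm + ∫ max_i (⟪a i, p⟫ - f i) dν(p)` over vectors `f` is a problem on a compact box, and its
Euler–Lagrange equation says that the gradient of the maximum transports `ν` to the target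
(`exists_integral_eq_integral_gradient_maxAffine`). The measure `μ` is approximated by the laws of
simple functions converging to the identity. The potentials so obtained are uniformly Lipschitz, the
Lipschitz constant being a bound for the norm on `P`, and a subsequence of them converges pointwise.
The laws are tight and `ν` has density bounded below, so by monotonicity of subgradients the
transport maps stay bounded at every interior point of `P`
(`exists_norm_le_of_isLegendreMax`). Therefore the transform of the limit is finite in the interior
of `P`, and the maps converge to its gradient wherever it is differentiable, which is almost
everywhere by Rademacher's theorem; dominated convergence concludes (`exists_transport`).
-/

namespace TransportedMA

/-! ### Convex functions: gradients, affine minorants, limits -/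

section ConvexAnalysis

variable {E : Type*} [NormedAddCommGroup E] [InnerProductSpace ℝ E]

theorem add_inner_le_of_hasGradientAt [CompleteSpace E] {s : Set E} {w : E → ℝ}
    (hw : ConvexOn ℝ s w) {x p q : E} (hp : p ∈ s) (hq : q ∈ s) (hx : HasGradientAt w x p) :
    w p + inner ℝ x (q - p) ≤ w q := by
  let ℓ : ℝ →ᵃ[ℝ] E := AffineMap.lineMap p q
  have hℓ : HasDerivAt ℓ (q - p) (0 : ℝ) := AffineMap.hasDerivAt_lineMap
  have hd : HasDerivAt (w ∘ ℓ) (inner ℝ x (q - p)) 0 := by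
    have h1 : HasFDerivAt w (InnerProductSpace.toDual ℝ E x) (ℓ 0) := by
      simpa [ℓ] using hx.hasFDerivAt
    simpa using h1.comp_hasDerivAt (0 : ℝ) hℓ
  have h := (hw.comp_affineMap ℓ).le_slope_of_hasDerivAt (x := 0) (y := 1)
    (by simpa [ℓ] using hp) (by simpa [ℓ] using hq) one_pos hd
  simp [slope_def_field, ℓ] at h
  linarith

theorem eq_of_hasGradientAt_of_eventually_le [CompleteSpace E] {w : E → ℝ} {x y p : E}
    (hx : HasGradientAt w x p) (hy : ∀ᶠ q in 𝓝 p, w p + inner ℝ y (q - p) ≤ w q) : y = x := by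
  have hmin : IsLocalMin (fun q => w q - inner ℝ y q) p := by
    filter_upwards [hy] with q hq
    rw [inner_sub_right] at hq
    linarith
  have hd := hx.hasFDerivAt.sub (InnerProductSpace.toDual ℝ E y).hasFDerivAt (x := p)
  have h0 := hmin.hasFDerivAt_eq_zero hd
  exact ((InnerProductSpace.toDual ℝ E).injective (sub_eq_zero.1 h0)).symm

/-- A convex function on an open set is locally Lipschitz, so Rademacher's theorem applies. -/
theorem ae_differentiableAt_of_convexOn [FiniteDimensional ℝ E] [MeasurableSpace E] [BorelSpace E]
    (ν : Measure E) [ν.IsAddHaarMeasure] {s : Set E} (hs : IsOpen s) {w : E → ℝ}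
    (hw : ConvexOn ℝ s w) : ∀ᵐ p ∂ν, p ∈ s → DifferentiableAt ℝ w p := by
  rw [ae_iff]
  refine measure_null_of_locally_null _ fun p hp => ?_
  simp only [Classical.not_imp, Set.mem_ofPred_eq] at hp
  obtain ⟨K, t, ht, hK⟩ := hw.locallyLipschitzOn hs hp.1
  rw [hs.nhdsWithin_eq hp.1] at ht
  refine ⟨{q | ¬(q ∈ s → DifferentiableAt ℝ w q)} ∩ interior t, inter_mem self_mem_nhdsWithin
    (mem_nhdsWithin_of_mem_nhds
      (isOpen_interior.mem_nhds (mem_interior_iff_mem_nhds.2 ht))), ?_⟩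
  refine measure_mono_null (fun q hq => ?_) (ae_iff.1 (hK.ae_differentiableWithinAt_of_mem (μ := ν)))
  simp only [Set.mem_inter_iff, Set.mem_ofPred_eq, Classical.not_imp] at hq ⊢
  exact ⟨interior_subset hq.2, fun h =>
    hq.1.2 (h.differentiableAt (mem_interior_iff_mem_nhds.1 hq.2))⟩

/-- Cutting the segment from `p` to `q` into `N` equal pieces, the increments of `w₂ - w₁` add up to
at most `⟪T q - T p, q - p⟫ / N`, since the bounds for the pieces telescope. -/
theorem sub_le_sub_of_common_subgradient {w₁ w₂ : E → ℝ} {T : E → E} {p q : E}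
    (h₁ : ∀ s t : ℚ, 0 ≤ s → s ≤ 1 → 0 ≤ t → t ≤ 1 →
      w₁ (p + (s : ℝ) • (q - p)) + inner ℝ (T (p + (s : ℝ) • (q - p)))
        ((p + (t : ℝ) • (q - p)) - (p + (s : ℝ) • (q - p))) ≤ w₁ (p + (t : ℝ) • (q - p)))
    (h₂ : ∀ s t : ℚ, 0 ≤ s → s ≤ 1 → 0 ≤ t → t ≤ 1 →
      w₂ (p + (s : ℝ) • (q - p)) + inner ℝ (T (p + (s : ℝ) • (q - p)))
        ((p + (t : ℝ) • (q - p)) - (p + (s : ℝ) • (q - p))) ≤ w₂ (p + (t : ℝ) • (q - p))) :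
    w₂ q - w₁ q ≤ w₂ p - w₁ p := by
  have key : ∀ N : ℕ, 0 < N →
      (w₂ q - w₁ q) - (w₂ p - w₁ p) ≤ inner ℝ (T q - T p) (q - p) / N := by
    intro N hN
    let c : ℕ → E := fun i => p + (((i / N : ℚ)) : ℝ) • (q - p)
    have hN' : (N : ℚ) ≠ 0 := by positivity
    have hNR : (N : ℝ) ≠ 0 := by positivity
    have h0 : c 0 = p := by simp [c]
    have h1 : c N = q := by simp [c, div_self hNR]
    have hc : ∀ i, c (i + 1) - c i = (1 / N : ℝ) • (q - p) := by
      intro i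
      simp only [c, add_sub_add_left_eq_sub, ← sub_smul]
      congr 1
      push_cast
      field_simp
      ring
    have hstep : ∀ i ∈ Finset.range N,
        (w₂ (c (i + 1)) - w₁ (c (i + 1))) - (w₂ (c i) - w₁ (c i)) ≤
          inner ℝ (T (c (i + 1))) (q - p) / N - inner ℝ (T (c i)) (q - p) / N := by
      intro i hi
      have hi' : i + 1 ≤ N := Finset.mem_range.1 hi
      have b1 : ((i : ℚ) / N) ≤ 1 := by
        rw [div_le_one (by positivity)]; exact_mod_cast (Nat.le_succ i).trans hi'
      have b2 : (((i + 1 : ℕ) : ℚ) / N) ≤ 1 := by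
        rw [div_le_one (by positivity)]; exact_mod_cast hi'
      have e1 : w₁ (c i) + inner ℝ (T (c i)) (c (i + 1) - c i) ≤ w₁ (c (i + 1)) :=
        h₁ _ _ (by positivity) b1 (by positivity) b2
      have e2 : w₂ (c (i + 1)) + inner ℝ (T (c (i + 1))) (c i - c (i + 1)) ≤ w₂ (c i) :=
        h₂ _ _ (by positivity) b2 (by positivity) b1
      rw [hc, inner_smul_right] at e1
      rw [← neg_sub (c (i + 1)) (c i), hc, inner_neg_right, inner_smul_right] at e2
      simp only [div_eq_inv_mul, mul_one] at e1 e2 ⊢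
      linarith
    have hsum := Finset.sum_le_sum hstep
    rw [Finset.sum_range_sub (fun i => w₂ (c i) - w₁ (c i)),
      Finset.sum_range_sub (fun i => inner ℝ (T (c i)) (q - p) / N), h0, h1] at hsum
    rwa [inner_sub_left, sub_div]
  have hlim : Tendsto (fun N : ℕ => inner ℝ (T q - T p) (q - p) / (N : ℝ)) atTop (𝓝 0) :=
    tendsto_const_div_atTop_nhds_zero_nat _
  have := ge_of_tendsto hlim (eventually_atTop.2 ⟨1, fun N hN => key N hN⟩)
  linarith

/-- Two convex functions on an open convex set whose gradients agree almost everywhere differ by a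
constant. -/
theorem sub_eq_sub_of_ae_hasGradientAt [FiniteDimensional ℝ E] [MeasurableSpace E] [BorelSpace E]
    (ν : Measure E) [ν.IsAddHaarMeasure] {U : Set E} (hU : IsOpen U) {w₁ w₂ : E → ℝ}
    (hw₁ : ConvexOn ℝ U w₁) (hw₂ : ConvexOn ℝ U w₂) {T : E → E}
    (hT : ∀ᵐ p ∂ν, p ∈ U → HasGradientAt w₁ (T p) p ∧ HasGradientAt w₂ (T p) p) {p q : E}
    (hp : p ∈ U) (hq : q ∈ U) : w₂ q - w₁ q = w₂ p - w₁ p := by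
  have key : ∀ p ∈ U, ∀ q ∈ U, w₂ q - w₁ q ≤ w₂ p - w₁ p := by
    intro p hp q hq
    -- For almost every `z`, all rational points of the segment translated by `z` are good.
    have hae : ∀ᵐ z ∂ν, ∀ t : ℚ, (p + (t : ℝ) • (q - p)) + z ∈ U →
        HasGradientAt w₁ (T ((p + (t : ℝ) • (q - p)) + z)) ((p + (t : ℝ) • (q - p)) + z) ∧
        HasGradientAt w₂ (T ((p + (t : ℝ) • (q - p)) + z)) ((p + (t : ℝ) • (q - p)) + z) :=
      ae_all_iff.2 fun t =>
        (measurePreserving_add_left ν (p + (t : ℝ) • (q - p))).quasiMeasurePreserving.ae hT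
    have hfreq := mem_closure_iff_frequently.1 ((Measure.dense_of_ae hae) (0 : E))
    -- A strict inequality the wrong way would persist for one of the small `z` just found.
    by_contra! hlt
    have hcp : ContinuousAt (fun z : E => p + z) 0 := by fun_prop
    have hcq : ContinuousAt (fun z : E => q + z) 0 := by fun_prop
    have hUp : U ∈ 𝓝 (p + 0) := by simpa using hU.mem_nhds hp
    have hUq : U ∈ 𝓝 (q + 0) := by simpa using hU.mem_nhds hq
    have c1 := (hw₁.continuousOn hU).continuousAt hUp
    have c2 := (hw₂.continuousOn hU).continuousAt hUp
    have c3 := (hw₁.continuousOn hU).continuousAt hUq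
    have c4 := (hw₂.continuousOn hU).continuousAt hUq
    have hF : ContinuousAt (fun z : E => (w₂ (q + z) - w₁ (q + z)) - (w₂ (p + z) - w₁ (p + z))) 0 :=
      ((c4.comp hcq).sub (c3.comp hcq)).sub ((c2.comp hcp).sub (c1.comp hcp))
    have hpos : ∀ᶠ z : E in 𝓝 0,
        0 < (w₂ (q + z) - w₁ (q + z)) - (w₂ (p + z) - w₁ (p + z)) :=
      hF.eventually_const_lt (by simpa using hlt)
    obtain ⟨z, hz, hzpos, hzp, hzq⟩ :=
      (hfreq.and_eventually (hpos.and ((hcp.eventually_mem hUp).and (hcq.eventually_mem hUq)))).exists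
    have hseg : ∀ t : ℚ, (p + z) + (t : ℝ) • ((q + z) - (p + z)) = (p + (t : ℝ) • (q - p)) + z := by
      intro t
      rw [add_sub_add_right_eq_sub]
      abel
    have hmem : ∀ t : ℚ, 0 ≤ t → t ≤ 1 → (p + (t : ℝ) • (q - p)) + z ∈ U := by
      intro t h0 h1
      rw [← hseg]
      exact hw₁.1.add_smul_sub_mem hzp hzq ⟨by exact_mod_cast h0, by exact_mod_cast h1⟩
    have := sub_le_sub_of_common_subgradient (w₁ := w₁) (w₂ := w₂) (T := T) (p := p + z) (q := q + z)
      (fun s t hs hs' ht ht' => by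
        rw [hseg, hseg]
        exact add_inner_le_of_hasGradientAt hw₁ (hmem s hs hs') (hmem t ht ht')
          (hz s (hmem s hs hs')).1)
      (fun s t hs hs' ht ht' => by
        rw [hseg, hseg]
        exact add_inner_le_of_hasGradientAt hw₂ (hmem s hs hs') (hmem t ht ht')
          (hz s (hmem s hs hs')).2)
    linarith
  exact le_antisymm (key p hp q hq) (key q hq p hp)

/-- Below a continuous convex function pass affine functions arbitrarily close to it at a given
point. -/
theorem exists_inner_add_le_of_lt [CompleteSpace E] {u : E → ℝ} (hu : ConvexOn ℝ Set.univ u)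
    (hc : Continuous u) {x : E} {a : ℝ} (ha : a < u x) :
    ∃ (q : E) (c : ℝ), (∀ y, inner ℝ y q + c ≤ u y) ∧ inner ℝ x q + c = a := by
  obtain ⟨l, c, hle, heq⟩ := hu.exists_affine_le_of_lt (𝕜 := ℝ) (Set.mem_univ x) ha isClosed_univ
    (hc.lowerSemicontinuous.lowerSemicontinuousOn _)
  refine ⟨(InnerProductSpace.toDual ℝ E).symm l, c, fun y => ?_, ?_⟩
  · have := hle ⟨y, Set.mem_univ y⟩
    rw [real_inner_comm]
    simpa using this
  · rw [real_inner_comm]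
    simpa using heq

/-- Arzelà–Ascoli for Lipschitz functions on a separable space, with pointwise convergence. -/
theorem exists_tendsto_subseq_of_lipschitzWith {X : Type*} [PseudoMetricSpace X]
    [TopologicalSpace.SeparableSpace X] {K : NNReal} {x₀ : X} {u : ℕ → X → ℝ}
    (hu : ∀ k, LipschitzWith K (u k)) (h0 : ∀ k, u k x₀ = 0) :
    ∃ φ : ℕ → ℕ, StrictMono φ ∧ ∃ v : X → ℝ, LipschitzWith K v ∧
      ∀ x, Tendsto (fun k => u (φ k) x) atTop (𝓝 (v x)) := by
  have : Nonempty X := ⟨x₀⟩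
  let D := TopologicalSpace.denseSeq X
  have hbd : ∀ k x, u k x ∈ Set.Icc (-(K * dist x x₀)) (K * dist x x₀) := by
    intro k x
    have := (hu k).dist_le_mul x x₀
    rw [h0, Real.dist_eq, sub_zero] at this
    exact abs_le.1 this
  have hcpt : IsCompact (Set.univ.pi fun i => Set.Icc (-(K * dist (D i) x₀)) (K * dist (D i) x₀)) :=
    isCompact_univ_pi fun i => isCompact_Icc
  obtain ⟨g, -, φ, hφ, hg⟩ := hcpt.tendsto_subseq (x := fun k i => u k (D i))
    (fun k i _ => hbd k (D i))
  rw [tendsto_pi_nhds] at hg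
  have hcau : ∀ x, CauchySeq (fun k => u (φ k) x) := by
    intro x
    rw [Metric.cauchySeq_iff']
    intro ε hε
    obtain ⟨i, hi⟩ := (TopologicalSpace.denseRange_denseSeq X).exists_dist_lt x
      (ε := ε / (4 * (K + 1))) (by positivity)
    have hi' : K * dist x (D i) ≤ ε / 4 := by
      calc K * dist x (D i) ≤ (K + 1) * (ε / (4 * (K + 1))) := by
            gcongr
            linarith
        _ = ε / 4 := by field_simp
    obtain ⟨N, hN⟩ := Metric.cauchySeq_iff'.1 (hg i).cauchySeq (ε / 4) (by positivity)
    refine ⟨N, fun k hk => ?_⟩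
    have h1 := (hu (φ k)).dist_le_mul x (D i)
    have h2 := (hu (φ N)).dist_le_mul x (D i)
    have h3 := hN k hk
    calc dist (u (φ k) x) (u (φ N) x)
        ≤ dist (u (φ k) x) (u (φ k) (D i)) + dist (u (φ k) (D i)) (u (φ N) (D i))
          + dist (u (φ N) (D i)) (u (φ N) x) := dist_triangle4 _ _ _ _
      _ < ε := by
          rw [dist_comm (u (φ N) (D i))]
          simp only [Function.comp_apply] at h3
          linarith
  choose v hv using fun x => cauchySeq_tendsto_of_complete (hcau x)
  refine ⟨φ, hφ, v, LipschitzWith.of_dist_le_mul fun x y => ?_, hv⟩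
  exact le_of_tendsto ((hv x).dist (hv y)) (Eventually.of_forall fun k => (hu _).dist_le_mul x y)

end ConvexAnalysis

/-! ### The Legendre transform -/

section Legendre

variable {n : ℕ} {u : EuclideanSpace ℝ (Fin n) → ℝ}

theorem legendre_ne_bot (u : EuclideanSpace ℝ (Fin n) → ℝ) (p : EuclideanSpace ℝ (Fin n)) :
    legendre u p ≠ ⊥ :=
  ne_bot_of_le_ne_bot (EReal.coe_ne_bot (inner ℝ 0 p - u 0))
    (le_iSup (fun x : EuclideanSpace ℝ (Fin n) => ((inner ℝ x p - u x : ℝ) : EReal)) 0)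

/-- Fenchel's inequality. -/
theorem inner_sub_le_toReal_legendre {p : EuclideanSpace ℝ (Fin n)} (hp : legendre u p ≠ ⊤)
    (x : EuclideanSpace ℝ (Fin n)) : inner ℝ x p - u x ≤ (legendre u p).toReal := by
  rw [← EReal.coe_le_coe_iff, EReal.coe_toReal hp (legendre_ne_bot u p)]
  exact le_iSup (fun x : EuclideanSpace ℝ (Fin n) => ((inner ℝ x p - u x : ℝ) : EReal)) x

theorem legendre_ne_top_of_le {p : EuclideanSpace ℝ (Fin n)} {c : ℝ}
    (h : ∀ x, inner ℝ x p - u x ≤ c) : legendre u p ≠ ⊤ :=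
  ne_top_of_le_ne_top (EReal.coe_ne_top c) (iSup_le fun x => EReal.coe_le_coe_iff.2 (h x))

theorem toReal_legendre_le {p : EuclideanSpace ℝ (Fin n)} {c : ℝ}
    (h : ∀ x, inner ℝ x p - u x ≤ c) : (legendre u p).toReal ≤ c := by
  rw [← EReal.coe_le_coe_iff, EReal.coe_toReal (legendre_ne_top_of_le h) (legendre_ne_bot u p)]
  exact iSup_le fun x => EReal.coe_le_coe_iff.2 (h x)

theorem convexOn_toReal_legendre (u : EuclideanSpace ℝ (Fin n) → ℝ) :
    ConvexOn ℝ {p | legendre u p ≠ ⊤} fun p => (legendre u p).toReal := by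
  have key : ∀ p, legendre u p ≠ ⊤ → ∀ q, legendre u q ≠ ⊤ → ∀ a b : ℝ, 0 ≤ a → 0 ≤ b →
      a + b = 1 → ∀ x, inner ℝ x (a • p + b • q) - u x ≤
        a • (legendre u p).toReal + b • (legendre u q).toReal := by
    intro p hp q hq a b ha hb hab x
    have h1 := mul_le_mul_of_nonneg_left (inner_sub_le_toReal_legendre hp x) ha
    have h2 := mul_le_mul_of_nonneg_left (inner_sub_le_toReal_legendre hq x) hb
    rw [inner_add_right, inner_smul_right, inner_smul_right, smul_eq_mul, smul_eq_mul]
    have : u x = a * u x + b * u x := by rw [← add_mul, hab, one_mul]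
    linarith
  exact ⟨fun p hp q hq a b ha hb hab => legendre_ne_top_of_le (key p hp q hq a b ha hb hab),
    fun p hp q hq a b ha hb hab => toReal_legendre_le (key p hp q hq a b ha hb hab)⟩

theorem le_supportFun {P : Set (EuclideanSpace ℝ (Fin n))} (hP : IsCompact P)
    {p : EuclideanSpace ℝ (Fin n)} (hp : p ∈ P) (x : EuclideanSpace ℝ (Fin n)) :
    inner ℝ x p ≤ supportFun P x :=
  le_csSup (hP.image (by fun_prop)).bddAbove ⟨p, hp, rfl⟩

theorem supportFun_le {P : Set (EuclideanSpace ℝ (Fin n))} (hP : P.Nonempty)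
    {x : EuclideanSpace ℝ (Fin n)} {c : ℝ} (h : ∀ p ∈ P, inner ℝ x p ≤ c) :
    supportFun P x ≤ c :=
  csSup_le (hP.image _) (by rintro _ ⟨p, hp, rfl⟩; exact h p hp)

/-- The Legendre transform of a function in the class of `P` is infinite off `P`: a hyperplane
strictly separating `p` from `P` is the direction in which `⟨x, p⟩ - u x` is unbounded. -/
theorem mem_of_legendre_ne_top {P : Set (EuclideanSpace ℝ (Fin n))} (hP : IsCompact P)
    (hPc : Convex ℝ P) (hne : P.Nonempty) {C : ℝ} (hC : ∀ x, u x ≤ supportFun P x + C)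
    {p : EuclideanSpace ℝ (Fin n)} (hp : legendre u p ≠ ⊤) : p ∈ P := by
  by_contra hpP
  obtain ⟨f, a, ha, hap⟩ := geometric_hahn_banach_closed_point hPc hP.isClosed hpP
  let x := (InnerProductSpace.toDual ℝ (EuclideanSpace ℝ (Fin n))).symm f
  have hx : ∀ q, inner ℝ x q = f q := fun q => by simp [x]
  obtain ⟨N, hN⟩ := exists_nat_gt (((legendre u p).toReal + C) / (f p - a))
  rw [div_lt_iff₀ (by linarith)] at hN
  have h1 := inner_sub_le_toReal_legendre hp ((N : ℝ) • x)
  have h2 : supportFun P ((N : ℝ) • x) ≤ N * a := supportFun_le hne fun q hq => by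
    rw [real_inner_smul_left, hx]
    exact mul_le_mul_of_nonneg_left (ha q hq).le (Nat.cast_nonneg N)
  have h3 := hC ((N : ℝ) • x)
  rw [real_inner_smul_left, hx] at h1
  linarith

theorem hasGradientAt_egrad {φ : EuclideanSpace ℝ (Fin n) → EReal} {p : EuclideanSpace ℝ (Fin n)}
    (hp : p ∈ gradDom φ) : HasGradientAt (fun q => (φ q).toReal) (egrad φ p) p :=
  hp.2.hasGradientAt

theorem measurable_gradient (w : EuclideanSpace ℝ (Fin n) → ℝ) : Measurable (gradient w) :=
  (InnerProductSpace.toDual ℝ (EuclideanSpace ℝ (Fin n))).symm.continuous.measurable.comp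
    (measurable_fderiv ℝ w)

/-- Equality holds in Fenchel's inequality at the gradient of the transform. -/
theorem apply_egrad_legendre (hu : ConvexOn ℝ Set.univ u) {p : EuclideanSpace ℝ (Fin n)}
    (hp : p ∈ gradDom (legendre u)) :
    u (egrad (legendre u) p) = inner ℝ (egrad (legendre u) p) p - (legendre u p).toReal := by
  have hfin : legendre u p ≠ ⊤ := hp.1.self_of_nhds.1
  set x := egrad (legendre u) p
  refine le_antisymm (le_of_forall_lt fun a ha => ?_) ?_
  · obtain ⟨b, hab, hb⟩ := exists_between ha
    obtain ⟨q, c, hq, hqx⟩ := exists_inner_add_le_of_lt hu hu.locallyLipschitz.continuous hb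
    have hle : ∀ y, inner ℝ y q - u y ≤ -c := fun y => by linarith [hq y]
    have h1 := toReal_legendre_le hle
    have h2 := add_inner_le_of_hasGradientAt (convexOn_toReal_legendre u) (p := p) (q := q) hfin
      (legendre_ne_top_of_le hle) (hasGradientAt_egrad hp)
    rw [inner_sub_right] at h2
    simp only [x] at hqx ⊢
    linarith
  · linarith [inner_sub_le_toReal_legendre hfin x]

/-- A point at which the supremum defining the transform is attained is its gradient. -/
theorem eq_egrad_legendre {p x : EuclideanSpace ℝ (Fin n)} (hp : p ∈ gradDom (legendre u))
    (hx : (legendre u p).toReal ≤ inner ℝ x p - u x) : x = egrad (legendre u) p := by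
  refine eq_of_hasGradientAt_of_eventually_le (hasGradientAt_egrad hp) ?_
  filter_upwards [hp.1] with q hq
  have := inner_sub_le_toReal_legendre hq.1 x
  rw [inner_sub_right]
  linarith

end Legendre

/-! ### Transport to finitely supported measures -/

section Discrete

variable {E : Type*} [NormedAddCommGroup E] [InnerProductSpace ℝ E]
variable {ι : Type*}

/-- The maximum of the affine functions `p ↦ ⟪a i, p⟫ - f i`: the Legendre transform of the
function equal to `f i` at `a i` and to `+∞` elsewhere. -/
noncomputable def maxAffine (a : ι → E) (f : ι → ℝ) (p : E) : ℝ :=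
  ⨆ i, (inner ℝ (a i) p - f i)

theorem le_maxAffine [Finite ι] (a : ι → E) (f : ι → ℝ) (p : E) (i : ι) :
    inner ℝ (a i) p - f i ≤ maxAffine a f p :=
  le_ciSup (f := fun i => inner ℝ (a i) p - f i) (Set.finite_range _).bddAbove i

theorem maxAffine_le [Nonempty ι] {a : ι → E} {f : ι → ℝ} {p : E} {c : ℝ}
    (h : ∀ i, inner ℝ (a i) p - f i ≤ c) : maxAffine a f p ≤ c :=
  ciSup_le h

theorem exists_eq_maxAffine [Finite ι] [Nonempty ι] (a : ι → E) (f : ι → ℝ) (p : E) :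
    ∃ i, inner ℝ (a i) p - f i = maxAffine a f p :=
  exists_eq_ciSup_of_finite

theorem convexOn_maxAffine [Finite ι] [Nonempty ι] (a : ι → E) (f : ι → ℝ) :
    ConvexOn ℝ Set.univ (maxAffine a f) := by
  refine ⟨convex_univ, fun p _ q _ s t hs ht hst => maxAffine_le fun i => ?_⟩
  have h1 := mul_le_mul_of_nonneg_left (le_maxAffine a f p i) hs
  have h2 := mul_le_mul_of_nonneg_left (le_maxAffine a f q i) ht
  rw [inner_add_right, inner_smul_right, inner_smul_right, smul_eq_mul, smul_eq_mul]
  have : f i = s * f i + t * f i := by rw [← add_mul, hst, one_mul]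
  linarith

theorem maxAffine_le_add_norm [Fintype ι] [Nonempty ι] (a : ι → E) (f f' : ι → ℝ) (p : E) :
    maxAffine a f p ≤ maxAffine a f' p + ‖f - f'‖ := by
  refine maxAffine_le fun i => ?_
  have h1 := le_maxAffine a f' p i
  have h2 := norm_le_pi_norm (f - f') i
  rw [Pi.sub_apply, Real.norm_eq_abs] at h2
  linarith [neg_abs_le (f i - f' i)]

variable [FiniteDimensional ℝ E]

theorem continuous_maxAffine [Finite ι] [Nonempty ι] (a : ι → E) (f : ι → ℝ) :
    Continuous (maxAffine a f) :=
  (convexOn_maxAffine a f).locallyLipschitz.continuous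

/-- At a point of differentiability, the slope of every affine function attaining the maximum is the
gradient. -/
theorem eq_gradient_maxAffine [Finite ι] {a : ι → E} {f : ι → ℝ} {p : E}
    (hp : DifferentiableAt ℝ (maxAffine a f) p) {i : ι}
    (hi : inner ℝ (a i) p - f i = maxAffine a f p) : a i = gradient (maxAffine a f) p := by
  refine eq_of_hasGradientAt_of_eventually_le hp.hasGradientAt (Eventually.of_forall fun q => ?_)
  have := le_maxAffine a f q i
  rw [inner_sub_right]
  linarith

/-- Increasing the data `f` by `t * h` lowers the maximum by exactly `t * h` at the gradient, for
small `t`, since no other affine function overtakes those attaining the maximum. -/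
theorem eventually_maxAffine_add_mul [Finite ι] [Nonempty ι] {a : ι → E} {f : ι → ℝ} {p : E}
    (hp : DifferentiableAt ℝ (maxAffine a f) p) (h : E → ℝ) :
    ∀ᶠ t in 𝓝 (0 : ℝ), maxAffine a (fun i => f i + t * h (a i)) p =
      maxAffine a f p - t * h (gradient (maxAffine a f) p) := by
  set x := gradient (maxAffine a f) p
  have hev : ∀ i, ∀ᶠ t in 𝓝 (0 : ℝ),
      inner ℝ (a i) p - (f i + t * h (a i)) ≤ maxAffine a f p - t * h x := by
    intro i
    rcases (le_maxAffine a f p i).eq_or_lt with hi | hi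
    · refine Eventually.of_forall fun t => ?_
      have hx : t * h (a i) = t * h x := congrArg (fun y => t * h y) (eq_gradient_maxAffine hp hi)
      linarith
    · have h1 : ContinuousAt (fun t : ℝ => inner ℝ (a i) p - (f i + t * h (a i))) 0 := by fun_prop
      have h2 : ContinuousAt (fun t : ℝ => maxAffine a f p - t * h x) 0 := by fun_prop
      exact (h1.eventually_lt h2 (by simpa using hi)).mono fun t ht => ht.le
  filter_upwards [eventually_all.2 hev] with t ht
  refine le_antisymm (maxAffine_le ht) ?_
  obtain ⟨i, hi⟩ := exists_eq_maxAffine a f p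
  have h1 := le_maxAffine a (fun i => f i + t * h (a i)) p i
  have h2 := congrArg (fun y => t * h y) (eq_gradient_maxAffine hp hi)
  simp only [x] at h1 h2 ⊢
  linarith

variable [MeasurableSpace E] [BorelSpace E]

theorem integrable_of_continuous_of_ae_mem {ν : Measure E} [IsFiniteMeasure ν] {P : Set E}
    (hP : IsCompact P) (hν : ∀ᵐ p ∂ν, p ∈ P) {w : E → ℝ} (hw : Continuous w) : Integrable w ν := by
  rw [← Measure.restrict_eq_self_of_ae_mem hν]
  exact hw.continuousOn.integrableOn_compact hP

/-- The Kantorovich functional of the semi-discrete transport problem from `ν` to the law of `a`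
under `m`. -/
noncomputable def dualCost [MeasurableSpace ι] (ν : Measure E) (m : Measure ι) (a : ι → E)
    (f : ι → ℝ) : ℝ :=
  ∫ i, f i ∂m + ∫ p, maxAffine a f p ∂ν

variable [MeasurableSpace ι] [MeasurableSingletonClass ι] {ν : Measure E} [IsProbabilityMeasure ν]
  {m : Measure ι} [IsProbabilityMeasure m] {P : Set E}

theorem dualCost_le_add_norm [Fintype ι] [Nonempty ι] (hP : IsCompact P)
    (hν : ∀ᵐ p ∂ν, p ∈ P) (a : ι → E) (f f' : ι → ℝ) :
    dualCost ν m a f ≤ dualCost ν m a f' + 2 * ‖f - f'‖ := by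
  have h1 : ∫ i, f i ∂m ≤ ∫ i, (f' i + ‖f - f'‖) ∂m := by
    refine integral_mono (.of_finite) (.of_finite) fun i => ?_
    have h2 := norm_le_pi_norm (f - f') i
    rw [Pi.sub_apply, Real.norm_eq_abs] at h2
    linarith [le_abs_self (f i - f' i)]
  have h2 : ∫ p, maxAffine a f p ∂ν ≤ ∫ p, (maxAffine a f' p + ‖f - f'‖) ∂ν :=
    integral_mono (integrable_of_continuous_of_ae_mem hP hν (continuous_maxAffine a f))
      (integrable_of_continuous_of_ae_mem hP hν ((continuous_maxAffine a f').add continuous_const))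
      fun p => maxAffine_le_add_norm a f f' p
  rw [integral_add (.of_finite) (.of_finite)] at h1
  rw [integral_add (integrable_of_continuous_of_ae_mem hP hν (continuous_maxAffine a f'))
    (integrable_const _)] at h2
  simp only [integral_const, probReal_univ, smul_eq_mul, one_mul] at h1 h2
  unfold dualCost
  linarith

/-- The functional is unchanged when a constant is added to `f`, and does not increase when `f` is
truncated at a height `M` above its minimum beyond which points cannot contribute to the maximum.
So it suffices to minimise over the box `[0, M]^ι`. -/
theorem exists_forall_dualCost_le [Finite ι] [Nonempty ι] (hP : IsCompact P)
    (hν : ∀ᵐ p ∂ν, p ∈ P) (a : ι → E) :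
    ∃ f, ∀ f', dualCost ν m a f ≤ dualCost ν m a f' := by
  have := Fintype.ofFinite ι
  obtain ⟨B, hB⟩ := hP.isBounded.exists_norm_le
  obtain ⟨A, hA⟩ := (Set.finite_range fun i => ‖a i‖).bddAbove
  have hA' : ∀ i, ‖a i‖ ≤ A := fun i => hA ⟨i, rfl⟩
  let M := 2 * A * |B|
  have hM : ∀ p ∈ P, ∀ i j, inner ℝ (a i) p - inner ℝ (a j) p ≤ M := by
    intro p hp i j
    have hp' : ‖p‖ ≤ |B| := (hB p hp).trans (le_abs_self B)
    have h1 : inner ℝ (a i) p ≤ A * |B| := (real_inner_le_norm _ _).trans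
      (mul_le_mul (hA' i) hp' (norm_nonneg _) ((norm_nonneg _).trans (hA' i)))
    have h2 : -inner ℝ (a j) p ≤ A * |B| := by
      rw [← inner_neg_left]
      refine (real_inner_le_norm _ _).trans ?_
      rw [norm_neg]
      exact mul_le_mul (hA' j) hp' (norm_nonneg _) ((norm_nonneg _).trans (hA' j))
    simp only [M]
    linarith
  have hM0 : 0 ≤ M := by
    have : 0 ≤ A := (norm_nonneg _).trans (hA' (Classical.arbitrary ι))
    positivity
  have hcont : Continuous (dualCost ν m a) := by
    refine (LipschitzWith.of_le_add_mul 2 fun f f' => ?_).continuous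
    rw [dist_eq_norm]
    exact dualCost_le_add_norm hP hν a f f'
  obtain ⟨f, -, hf⟩ := (isCompact_Icc (a := (0 : ι → ℝ)) (b := fun _ => M)).exists_isMinOn
    ⟨0, le_rfl, fun _ => hM0⟩ hcont.continuousOn
  refine ⟨f, fun f' => ?_⟩
  obtain ⟨j, hj⟩ := Finite.exists_min f'
  let g : ι → ℝ := fun i => min (f' i - f' j) M
  have hg : g ∈ Set.Icc (0 : ι → ℝ) (fun _ => M) :=
    ⟨fun i => le_min (sub_nonneg.2 (hj i)) hM0, fun i => min_le_right _ _⟩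
  refine (hf hg).trans ?_
  have h1 : ∫ i, g i ∂m ≤ ∫ i, (f' i - f' j) ∂m :=
    integral_mono (.of_finite) (.of_finite) fun i => min_le_left _ _
  have h2 : ∫ p, maxAffine a g p ∂ν ≤ ∫ p, (maxAffine a f' p + f' j) ∂ν := by
    refine integral_mono_ae (integrable_of_continuous_of_ae_mem hP hν (continuous_maxAffine a g))
      (integrable_of_continuous_of_ae_mem hP hν ((continuous_maxAffine a f').add continuous_const)) ?_
    filter_upwards [hν] with p hp
    refine maxAffine_le fun i => ?_
    rcases min_choice (f' i - f' j) M with h | h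
    · have := le_maxAffine a f' p i
      simp only [g, h]
      linarith
    · have h1 := le_maxAffine a f' p j
      have h2 := hM p hp i j
      simp only [g, h]
      linarith
  rw [integral_sub (.of_finite) (.of_finite)] at h1
  rw [integral_add (integrable_of_continuous_of_ae_mem hP hν (continuous_maxAffine a f'))
    (integrable_const _)] at h2
  simp only [integral_const, probReal_univ, smul_eq_mul, one_mul] at h1 h2
  unfold dualCost
  linarith

/-- The Euler–Lagrange equation of the semi-discrete problem. -/
theorem exists_integral_eq_integral_gradient_maxAffine [Finite ι] [Nonempty ι]
    {κ : Measure E} [κ.IsAddHaarMeasure]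
    (hP : IsCompact P) (hν : ∀ᵐ p ∂ν, p ∈ P) (hac : ν ≪ κ) (a : ι → E) :
    ∃ f : ι → ℝ, (∀ᵐ p ∂ν, DifferentiableAt ℝ (maxAffine a f) p) ∧
      ∀ h : E →ᵇ ℝ, ∫ i, h (a i) ∂m = ∫ p, h (gradient (maxAffine a f) p) ∂ν := by
  obtain ⟨f, hf⟩ := exists_forall_dualCost_le (m := m) hP hν a
  have hdiff : ∀ᵐ p ∂ν, DifferentiableAt ℝ (maxAffine a f) p := by
    filter_upwards [hac.ae_le (ae_differentiableAt_of_convexOn κ isOpen_univ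
      (convexOn_maxAffine a f))] with p hp using hp trivial
  refine ⟨f, hdiff, ?_⟩
  -- The one-sided derivative of the functional at its minimum in the direction `h` is nonnegative;
  -- applied to `h` and `-h` this gives equality.
  have key : ∀ h : E →ᵇ ℝ, ∫ p, h (gradient (maxAffine a f) p) ∂ν ≤ ∫ i, h (a i) ∂m := by
    intro h
    let t : ℕ → ℝ := fun k => 1 / ((k : ℝ) + 1)
    have ht0 : ∀ k, 0 < t k := fun k => by positivity
    have ht : Tendsto t atTop (𝓝 0) := tendsto_one_div_add_atTop_nhds_zero_nat
    let F : ℕ → E → ℝ := fun k p =>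
      (maxAffine a (fun i => f i + t k * h (a i)) p - maxAffine a f p) / t k
    have hint : ∀ k, Integrable (F k) ν := fun k => integrable_of_continuous_of_ae_mem hP hν
      (((continuous_maxAffine a _).sub (continuous_maxAffine a f)).div_const _)
    have hlim : Tendsto (fun k => ∫ p, F k p ∂ν) atTop
        (𝓝 (∫ p, -h (gradient (maxAffine a f) p) ∂ν)) := by
      refine tendsto_integral_of_dominated_convergence (fun _ => ‖h‖)
        (fun k => (hint k).aestronglyMeasurable) (integrable_const _) (fun k => ?_) ?_
      · refine Eventually.of_forall fun p => ?_
        rw [Real.norm_eq_abs, abs_div, abs_of_pos (ht0 k), div_le_iff₀ (ht0 k), abs_sub_le_iff]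
        have hb : ∀ i, |t k * h (a i)| ≤ ‖h‖ * t k := fun i => by
          rw [abs_mul, abs_of_pos (ht0 k), mul_comm]
          exact mul_le_mul_of_nonneg_right (h.norm_coe_le_norm _) (ht0 k).le
        constructor
        · rw [sub_le_iff_le_add]
          refine maxAffine_le fun i => ?_
          linarith [le_maxAffine a f p i, neg_abs_le (t k * h (a i)), hb i]
        · rw [sub_le_iff_le_add]
          refine maxAffine_le fun i => ?_
          linarith [le_maxAffine a (fun i => f i + t k * h (a i)) p i,
            le_abs_self (t k * h (a i)), hb i]
      · filter_upwards [hdiff] with p hp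
        refine tendsto_const_nhds.congr' ?_
        filter_upwards [ht.eventually (eventually_maxAffine_add_mul hp h)] with k hk
        simp only [F, hk]
        field_simp [(ht0 k).ne']
        ring
    have hnonneg : ∀ k, -∫ i, h (a i) ∂m ≤ ∫ p, F k p ∂ν := by
      intro k
      have h1 := hf (fun i => f i + t k * h (a i))
      unfold dualCost at h1
      rw [integral_add (.of_finite) (.of_finite), integral_const_mul] at h1
      simp only [F]
      rw [integral_div, integral_sub
        (integrable_of_continuous_of_ae_mem hP hν (continuous_maxAffine a _))
        (integrable_of_continuous_of_ae_mem hP hν (continuous_maxAffine a f)), le_div_iff₀ (ht0 k)]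
      linarith
    have := ge_of_tendsto hlim (Eventually.of_forall hnonneg)
    rw [integral_neg] at this
    linarith
  intro h
  refine le_antisymm ?_ (key h)
  have := key (-h)
  simp only [BoundedContinuousFunction.coe_neg, Pi.neg_apply, integral_neg] at this
  linarith

end Discrete

/-! ### Existence by approximation -/

section Existence

variable {n : ℕ}

/-- `x` attains the supremum that defines the Legendre transform of `u` at `p`. -/
def IsLegendreMax {E : Type*} [NormedAddCommGroup E] [InnerProductSpace ℝ E] (u : E → ℝ)
    (p x : E) : Prop :=
  ∀ y, inner ℝ y p - u y ≤ inner ℝ x p - u x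

/-- The Legendre transform over a compact set `P` of a continuous function `φ`, normalised to vanish
at `0`. The slope of an affine minorant of `φ` on `P` touching `φ` at `p` attains the supremum that
defines the transform of the resulting function at `p`. -/
theorem exists_convexOn_isLegendreMax {P : Set (EuclideanSpace ℝ (Fin n))} (hP : IsCompact P)
    (hne : P.Nonempty) {K : NNReal} (hK : ∀ p ∈ P, ‖p‖ ≤ K) {φ : EuclideanSpace ℝ (Fin n) → ℝ}
    (hφ : Continuous φ) :
    ∃ u : EuclideanSpace ℝ (Fin n) → ℝ, ConvexOn ℝ Set.univ u ∧ LipschitzWith K u ∧ u 0 = 0 ∧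
      (∀ x, u x ≤ supportFun P x) ∧
      ∀ p ∈ P, ∀ x f, inner ℝ x p - f = φ p → (∀ q ∈ P, inner ℝ x q - f ≤ φ q) →
        IsLegendreMax u p x := by
  let v : EuclideanSpace ℝ (Fin n) → ℝ := fun x => sSup ((fun p => inner ℝ x p - φ p) '' P)
  have hbdd : ∀ x, BddAbove ((fun p => inner ℝ x p - φ p) '' P) := fun x =>
    (hP.image (by fun_prop)).bddAbove
  have hle : ∀ x, ∀ p ∈ P, inner ℝ x p - φ p ≤ v x := fun x p hp => le_csSup (hbdd x) ⟨p, hp, rfl⟩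
  have hge : ∀ x c, (∀ p ∈ P, inner ℝ x p - φ p ≤ c) → v x ≤ c := fun x c h =>
    csSup_le (hne.image _) (by rintro _ ⟨p, hp, rfl⟩; exact h p hp)
  refine ⟨fun x => v x - v 0, ?_, ?_, sub_self _, ?_, ?_⟩
  · refine ⟨convex_univ, fun x _ y _ s t hs ht hst => ?_⟩
    have h : v (s • x + t • y) ≤ s * v x + t * v y := by
      refine hge _ _ fun p hp => ?_
      have h1 := mul_le_mul_of_nonneg_left (hle x p hp) hs
      have h2 := mul_le_mul_of_nonneg_left (hle y p hp) ht
      rw [inner_add_left, real_inner_smul_left, real_inner_smul_left]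
      have : φ p = s * φ p + t * φ p := by rw [← add_mul, hst, one_mul]
      linarith
    have h0 : v 0 = s * v 0 + t * v 0 := by rw [← add_mul, hst, one_mul]
    simp only [smul_eq_mul]
    linarith
  · refine LipschitzWith.of_le_add_mul K fun x y => ?_
    have : v x ≤ v y + K * dist x y := by
      refine hge _ _ fun p hp => ?_
      have h1 := hle y p hp
      have h2 : inner ℝ (x - y) p ≤ K * dist x y := by
        rw [dist_eq_norm, mul_comm]
        exact (real_inner_le_norm _ _).trans
          (mul_le_mul_of_nonneg_left (hK p hp) (norm_nonneg _))
      rw [inner_sub_left] at h2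
      linarith
    linarith
  · intro x
    rw [sub_le_iff_le_add]
    refine hge _ _ fun p hp => ?_
    have h1 := le_supportFun hP hp x
    have h2 := hle 0 p hp
    rw [inner_zero_left] at h2
    linarith
  · intro p hp x f hx hf y
    have h1 := hle y p hp
    have h2 : v x ≤ f := hge _ _ fun q hq => by linarith [hf q hq]
    simp only
    linarith

/-- Transport of `ν` to a finitely supported measure, the law of the simple function `s`: the map `T`
sends almost every `p` to a point attaining the supremum that defines the transform of `u` at `p`.
Such points exist at every `p ∈ P`, which is what makes the transform of a limit of such `u` finite
on the whole interior of `P`. -/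
theorem exists_transport_to_simpleFunc {P : Set (EuclideanSpace ℝ (Fin n))} (hP : IsCompact P)
    (hne : P.Nonempty) {K : NNReal} (hK : ∀ p ∈ P, ‖p‖ ≤ K)
    {ν : Measure (EuclideanSpace ℝ (Fin n))} [IsProbabilityMeasure ν] (hν : ∀ᵐ p ∂ν, p ∈ P)
    (hac : ν ≪ volume) (μ : Measure (EuclideanSpace ℝ (Fin n))) [IsProbabilityMeasure μ]
    (s : SimpleFunc (EuclideanSpace ℝ (Fin n)) (EuclideanSpace ℝ (Fin n))) :
    ∃ (u : EuclideanSpace ℝ (Fin n) → ℝ) (T : EuclideanSpace ℝ (Fin n) → EuclideanSpace ℝ (Fin n)),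
      ConvexOn ℝ Set.univ u ∧ LipschitzWith K u ∧ u 0 = 0 ∧ (∀ x, u x ≤ supportFun P x) ∧
      (∀ p ∈ P, ∃ x, IsLegendreMax u p x) ∧ Measurable T ∧ (∀ᵐ p ∂ν, IsLegendreMax u p (T p)) ∧
      ∀ h : EuclideanSpace ℝ (Fin n) →ᵇ ℝ, ∫ p, h (T p) ∂ν = ∫ x, h (s x) ∂μ := by
  let σ : EuclideanSpace ℝ (Fin n) → s.range := fun x => ⟨s x, s.mem_range_self x⟩
  have hσ : Measurable σ := s.measurable.subtype_mk
  have : Nonempty s.range := ⟨σ 0⟩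
  have : IsProbabilityMeasure (μ.map σ) := Measure.isProbabilityMeasure_map hσ.aemeasurable
  let a : s.range → EuclideanSpace ℝ (Fin n) := Subtype.val
  obtain ⟨f, hdiff, hf⟩ :=
    exists_integral_eq_integral_gradient_maxAffine (m := μ.map σ) hP hν hac a
  obtain ⟨u, hu, hlip, hu0, hus, hmax⟩ :=
    exists_convexOn_isLegendreMax hP hne hK (continuous_maxAffine a f)
  have hmax' : ∀ p ∈ P, ∀ i, inner ℝ (a i) p - f i = maxAffine a f p →
      IsLegendreMax u p (a i) := fun p hp i hi =>
    hmax p hp (a i) (f i) hi fun q _ => le_maxAffine a f q i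
  refine ⟨u, gradient (maxAffine a f), hu, hlip, hu0, hus, fun p hp => ?_,
    measurable_gradient _, ?_, fun h => ?_⟩
  · obtain ⟨i, hi⟩ := exists_eq_maxAffine a f p
    exact ⟨a i, hmax' p hp i hi⟩
  · filter_upwards [hν, hdiff] with p hp hd
    obtain ⟨i, hi⟩ := exists_eq_maxAffine a f p
    rw [← eq_gradient_maxAffine hd hi]
    exact hmax' p hp i hi
  · rw [← hf h, integral_map hσ.aemeasurable]
    exact (measurable_of_finite _).aestronglyMeasurable

/-- By monotonicity of subgradients, a subgradient `y` at `p` forces comparably large subgradients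
on a whole ball lying in the direction of `y` from `p`. -/
theorem norm_le_of_isLegendreMax {E : Type*} [NormedAddCommGroup E] [InnerProductSpace ℝ E]
    {u : E → ℝ} {p q x y : E} {δ : ℝ} (hδ : 0 < δ) (hy : IsLegendreMax u p y)
    (hx : IsLegendreMax u q x) (hq : q ∈ Metric.ball (p + (δ / ‖y‖) • y) (δ / 2)) :
    ‖y‖ ≤ 3 * ‖x‖ := by
  rcases eq_or_ne y 0 with rfl | hy0
  · simp
  have hyn : 0 < ‖y‖ := norm_pos_iff.2 hy0
  obtain ⟨r, rfl⟩ : ∃ r, q = p + (δ / ‖y‖) • y + r := ⟨q - (p + (δ / ‖y‖) • y), by abel⟩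
  rw [mem_ball_iff_norm, add_sub_cancel_left] at hq
  set d := (δ / ‖y‖) • y + r with hd
  have hqd : p + (δ / ‖y‖) • y + r = p + d := by rw [hd, add_assoc]
  rw [hqd] at hx
  have h1 := hx y
  have h2 := hy x
  rw [inner_add_right y p d, inner_add_right x p d] at h1
  have hnorm : ‖(δ / ‖y‖) • y‖ = δ := by
    rw [norm_smul, Real.norm_eq_abs, abs_of_pos (by positivity), div_mul_cancel₀ _ hyn.ne']
  have hdn : ‖d‖ ≤ 3 / 2 * δ := by
    refine (norm_add_le _ _).trans ?_
    rw [hnorm]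
    linarith
  have h3 : inner ℝ x d ≤ ‖x‖ * (3 / 2 * δ) :=
    (real_inner_le_norm _ _).trans (mul_le_mul_of_nonneg_left hdn (norm_nonneg _))
  have h4 : δ * ‖y‖ - ‖y‖ * (δ / 2) ≤ inner ℝ y d := by
    rw [hd, inner_add_right, inner_smul_right, real_inner_self_eq_norm_sq]
    have : δ / ‖y‖ * ‖y‖ ^ 2 = δ * ‖y‖ := by field_simp
    have h5 : -inner ℝ y r ≤ ‖y‖ * (δ / 2) := by
      rw [← inner_neg_right]
      refine (real_inner_le_norm _ _).trans ?_
      rw [norm_neg]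
      exact mul_le_mul_of_nonneg_left hq.le (norm_nonneg _)
    linarith
  have h6 : δ * ‖y‖ ≤ δ * (3 * ‖x‖) := by linarith
  exact le_of_mul_le_mul_left h6 hδ

/-- A continuous cutoff, equal to `0` where `‖x‖ ≤ R` and to `1` where `‖x‖ ≥ R + 1`. -/
noncomputable def normCutoff (E : Type*) [NormedAddCommGroup E] (R : ℝ) : E →ᵇ ℝ :=
  BoundedContinuousFunction.ofNormedAddCommGroup (fun x => min 1 (max 0 (‖x‖ - R)))
    (by fun_prop) 1 fun x => by
      rw [Real.norm_eq_abs, abs_of_nonneg (by positivity)]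
      exact min_le_left _ _

theorem normCutoff_apply {E : Type*} [NormedAddCommGroup E] (R : ℝ) (x : E) :
    normCutoff E R x = min 1 (max 0 (‖x‖ - R)) := rfl

theorem tendsto_integral_normCutoff {E : Type*} [NormedAddCommGroup E] [MeasurableSpace E]
    [BorelSpace E] [SecondCountableTopology E] (μ : Measure E) [IsFiniteMeasure μ] :
    Tendsto (fun N : ℕ => ∫ x, normCutoff E N ((2 : ℕ) • x) ∂μ) atTop (𝓝 0) := by
  have h : Tendsto (fun N : ℕ => ∫ x, normCutoff E N ((2 : ℕ) • x) ∂μ) atTop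
      (𝓝 (∫ _, (0 : ℝ) ∂μ)) := by
    refine tendsto_integral_of_dominated_convergence (fun _ => 1)
      (fun N => ?_) (integrable_const _) (fun N => Eventually.of_forall fun x => ?_)
      (Eventually.of_forall fun x => ?_)
    · have : Continuous fun x : E => normCutoff E N ((2 : ℕ) • x) :=
        (normCutoff E N).continuous.comp (continuous_nsmul 2)
      exact this.aestronglyMeasurable
    · rw [normCutoff_apply, Real.norm_eq_abs, abs_of_nonneg (by positivity)]
      exact min_le_left _ _
    · refine tendsto_const_nhds.congr' ?_
      obtain ⟨N₀, hN₀⟩ := exists_nat_ge ‖(2 : ℕ) • x‖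
      filter_upwards [eventually_ge_atTop N₀] with N hN
      have : (N₀ : ℝ) ≤ N := by exact_mod_cast hN
      rw [normCutoff_apply, max_eq_left (by linarith)]
      simp
  simpa using h

/-- Subgradients at a fixed interior point of `P` are bounded along a sequence of transports whose
targets are tight: otherwise a fixed amount of mass around the point would be sent far away. -/
theorem exists_norm_le_of_isLegendreMax {E : Type*} [NormedAddCommGroup E] [InnerProductSpace ℝ E]
    [FiniteDimensional ℝ E] [MeasurableSpace E] [BorelSpace E] {P : Set E}
    {ν : Measure E} [IsProbabilityMeasure ν] {c : ENNReal} (hc : c ≠ 0)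
    (hlb : c • (volume : Measure E).restrict P ≤ ν) {μ : Measure E} [IsProbabilityMeasure μ]
    {s : ℕ → E → E} (hsm : ∀ k, Measurable (s k)) (hs : ∀ k x, ‖s k x‖ ≤ ‖x‖ + ‖x‖)
    {u : ℕ → E → ℝ} {T : ℕ → E → E} (hTm : ∀ k, Measurable (T k))
    (hT : ∀ k, ∀ᵐ p ∂ν, IsLegendreMax (u k) p (T k p))
    (hint : ∀ k, ∀ h : E →ᵇ ℝ, ∫ p, h (T k p) ∂ν = ∫ x, h (s k x) ∂μ)
    {p : E} (hp : p ∈ interior P) :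
    ∃ R : ℝ, ∀ k y, IsLegendreMax (u k) p y → ‖y‖ ≤ R := by
  obtain ⟨δ₀, hδ₀, hball⟩ := Metric.mem_nhds_iff.1 (mem_interior_iff_mem_nhds.1 hp)
  let δ := δ₀ / 2
  have hδ : 0 < δ := by positivity
  let m₀ : ENNReal := c * volume (Metric.ball (0 : E) (δ / 2))
  have hsub : ∀ y : E, Metric.ball (p + (δ / ‖y‖) • y) (δ / 2) ⊆ P := by
    intro y
    refine (Metric.ball_subset_ball' ?_).trans hball
    rw [dist_eq_norm, add_sub_cancel_left, norm_smul, Real.norm_eq_abs, abs_of_nonneg (by positivity)]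
    have : δ / ‖y‖ * ‖y‖ ≤ δ := by
      rcases eq_or_ne ‖y‖ 0 with h | h
      · rw [h, mul_zero]; exact hδ.le
      · rw [div_mul_cancel₀ _ h]
    simp only [δ] at this ⊢
    linarith
  have hm : ∀ y : E, m₀ ≤ ν (Metric.ball (p + (δ / ‖y‖) • y) (δ / 2)) := by
    intro y
    refine le_trans (le_of_eq ?_) (hlb _)
    rw [Measure.smul_apply, Measure.restrict_apply Metric.isOpen_ball.measurableSet,
      Set.inter_eq_self_of_subset_left (hsub y), smul_eq_mul,
      Measure.addHaar_ball_center volume (p + (δ / ‖y‖) • y)]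
  have hm0 : 0 < m₀.toReal := by
    refine ENNReal.toReal_pos (mul_ne_zero hc (Metric.measure_ball_pos volume _ (by positivity)).ne')
      (ne_top_of_le_ne_top (measure_ne_top ν _) (hm 0))
  obtain ⟨N, hN⟩ := ((tendsto_integral_normCutoff μ).eventually_lt_const hm0).exists
  -- If `‖y‖ > 3 (N + 1)`, the whole ball `B` below, of mass at least `m₀`, is sent to where the
  -- cutoff is `1`, while the integral of the cutoff against the target is less than `m₀`.
  refine ⟨3 * (N + 1), fun k y hy => ?_⟩
  by_contra! hlt
  set B := Metric.ball (p + (δ / ‖y‖) • y) (δ / 2)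
  have h1 : ∫ x, normCutoff E N (s k x) ∂μ ≤ ∫ x, normCutoff E N ((2 : ℕ) • x) ∂μ := by
    have hb : ∀ x, ‖normCutoff E N x‖ ≤ ‖normCutoff E (N : ℝ)‖ := (normCutoff E N).norm_coe_le_norm
    refine integral_mono (Integrable.of_bound
      ((normCutoff E N).continuous.measurable.comp (hsm k)).aestronglyMeasurable _
      (Eventually.of_forall fun x => hb _)) (Integrable.of_bound
      ((normCutoff E N).continuous.comp (continuous_nsmul 2)).aestronglyMeasurable _
      (Eventually.of_forall fun x => hb _)) fun x => ?_
    have : ‖(2 : ℕ) • x‖ = ‖x‖ + ‖x‖ := by rw [two_nsmul, ← two_smul ℝ, norm_smul]; norm_num; ring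
    simp only [normCutoff_apply, this]
    gcongr
    exact hs k x
  have h2 : ν.real B ≤ ∫ q, normCutoff E N (T k q) ∂ν := by
    rw [← integral_indicator_one Metric.isOpen_ball.measurableSet]
    refine integral_mono_ae ((integrable_const (1 : ℝ)).indicator Metric.isOpen_ball.measurableSet)
      (Integrable.of_bound
      ((normCutoff E N).continuous.measurable.comp (hTm k)).aestronglyMeasurable _
      (Eventually.of_forall fun x => (normCutoff E N).norm_coe_le_norm _)) ?_
    filter_upwards [hT k] with q hq
    by_cases hqB : q ∈ B
    · have := norm_le_of_isLegendreMax hδ hy hq hqB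
      rw [Set.indicator_of_mem hqB, normCutoff_apply, max_eq_right (by linarith),
        min_eq_left (by linarith)]
      rfl
    · rw [Set.indicator_of_notMem hqB, normCutoff_apply]
      positivity
  have h3 : m₀.toReal ≤ ν.real B := ENNReal.toReal_mono (measure_ne_top ν _) (hm y)
  rw [hint k (normCutoff E N)] at h2
  linarith

theorem IsLegendreMax.of_tendsto {E : Type*} [NormedAddCommGroup E] [InnerProductSpace ℝ E]
    {κ : Type*} {l : Filter κ} [l.NeBot] {K : NNReal} {u : κ → E → ℝ} {v : E → ℝ}
    (hu : ∀ k, LipschitzWith K (u k)) (hv : ∀ x, Tendsto (fun k => u k x) l (𝓝 (v x)))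
    {p x₀ : E} {x : κ → E} (hx : Tendsto x l (𝓝 x₀)) (hmax : ∀ k, IsLegendreMax (u k) p (x k)) :
    IsLegendreMax v p x₀ := by
  have hux : Tendsto (fun k => u k (x k)) l (𝓝 (v x₀)) := by
    refine (hv x₀).congr_dist (squeeze_zero (fun _ => dist_nonneg)
      (fun k => (hu k).dist_le_mul _ _) ?_)
    simpa [dist_comm] using (hx.dist (tendsto_const_nhds (x := x₀))).const_mul (K : ℝ)
  intro y
  exact le_of_tendsto_of_tendsto' (tendsto_const_nhds.sub (hv y))
    (((hx.inner tendsto_const_nhds)).sub hux) fun k => hmax k y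

theorem ae_mem_interior_of_convex {P : Set (EuclideanSpace ℝ (Fin n))} (hPc : Convex ℝ P) :
    ∀ᵐ p ∂(volume : Measure (EuclideanSpace ℝ (Fin n))), p ∈ P → p ∈ interior P := by
  filter_upwards [measure_eq_zero_iff_ae_notMem.1 (hPc.addHaar_frontier volume)] with p hp hpP
  by_contra h
  exact hp ⟨subset_closure hpP, h⟩

/-- Existence of the transport: `u` is a limit of solutions for finitely supported approximations
of `μ`, and their transport maps converge almost everywhere to the gradient of the transform. -/
theorem exists_transport {P : Set (EuclideanSpace ℝ (Fin n))} (hP : IsCompact P)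
    (hPc : Convex ℝ P) (hne : P.Nonempty)
    {ν : Measure (EuclideanSpace ℝ (Fin n))} [IsProbabilityMeasure ν]
    (hac : ν ≪ volume.restrict P) {c : ENNReal} (hc : c ≠ 0)
    (hlb : c • (volume : Measure (EuclideanSpace ℝ (Fin n))).restrict P ≤ ν)
    (μ : Measure (EuclideanSpace ℝ (Fin n))) [IsProbabilityMeasure μ] :
    ∃ u ∈ ConvexClass P, (∀ᵐ p ∂(volume.restrict P), p ∈ gradDom (legendre u)) ∧
      ∀ h : EuclideanSpace ℝ (Fin n) →ᵇ ℝ, ∫ x, h x ∂μ = ∫ p, h (egrad (legendre u) p) ∂ν := by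
  obtain ⟨K₀, hK₀⟩ := hP.isBounded.exists_norm_le
  have hK : ∀ p ∈ P, ‖p‖ ≤ K₀.toNNReal := fun p hp => (hK₀ p hp).trans (Real.le_coe_toNNReal K₀)
  have hν : ∀ᵐ p ∂ν, p ∈ P := hac.ae_le (ae_restrict_mem hP.measurableSet)
  let s : ℕ → SimpleFunc (EuclideanSpace ℝ (Fin n)) (EuclideanSpace ℝ (Fin n)) :=
    SimpleFunc.approxOn id measurable_id Set.univ 0 (Set.mem_univ _)
  choose u T hu hlip hu0 hus hex hTm hTmax hint using fun k =>
    exists_transport_to_simpleFunc hP hne hK hν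
      (hac.trans Measure.restrict_le_self.absolutelyContinuous) μ (s k)
  have hbound : ∀ p ∈ interior P, ∃ R : ℝ, ∀ k y, IsLegendreMax (u k) p y → ‖y‖ ≤ R :=
    fun p hp => exists_norm_le_of_isLegendreMax hc hlb (fun k => (s k).measurable)
      (fun k x => SimpleFunc.norm_approxOn_zero_le measurable_id (Set.mem_univ _) x k)
      hTm hTmax hint hp
  obtain ⟨φ, hφ, v, hvlip, hv⟩ := exists_tendsto_subseq_of_lipschitzWith hlip hu0
  have hvconv : ConvexOn ℝ Set.univ v := by
    refine ⟨convex_univ, fun x _ y _ a b ha hb hab => ?_⟩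
    exact le_of_tendsto_of_tendsto' (hv _) (((hv x).const_smul a).add ((hv y).const_smul b))
      fun k => (hu (φ k)).2 trivial trivial ha hb hab
  have hmaxlim : ∀ p ∈ interior P, ∀ (ψ : ℕ → ℕ), Tendsto ψ atTop atTop →
      ∀ x : ℕ → EuclideanSpace ℝ (Fin n), (∀ k, IsLegendreMax (u (φ (ψ k))) p (x k)) →
      ∃ x₀, IsLegendreMax v p x₀ ∧ ∃ θ : ℕ → ℕ, Tendsto (x ∘ θ) atTop (𝓝 x₀) := by
    intro p hp ψ hψ x hx
    obtain ⟨R, hR⟩ := hbound p hp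
    obtain ⟨x₀, -, θ, hθ, hlim⟩ := (isCompact_closedBall (0 : EuclideanSpace ℝ (Fin n)) R).tendsto_subseq
      (x := x) fun k => mem_closedBall_zero_iff.2 (hR _ _ (hx k))
    exact ⟨x₀, IsLegendreMax.of_tendsto (fun k => hlip (φ (ψ (θ k))))
      (fun y => (hv y).comp (hψ.comp hθ.tendsto_atTop)) hlim fun k => hx (θ k), θ, hlim⟩
  have hfin : interior P ⊆ {p | legendre v p ≠ ⊤} := by
    intro p hp
    choose x hx using fun k => hex (φ k) p (interior_subset hp)
    obtain ⟨x₀, hx₀, -⟩ := hmaxlim p hp id tendsto_id x hx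
    exact legendre_ne_top_of_le hx₀
  have hdom : ∀ᵐ p ∂(volume : Measure (EuclideanSpace ℝ (Fin n))),
      p ∈ P → p ∈ interior P ∧ p ∈ gradDom (legendre v) := by
    filter_upwards [ae_mem_interior_of_convex hPc,
      ae_differentiableAt_of_convexOn volume isOpen_interior
        ((convexOn_toReal_legendre v).subset hfin hPc.interior)] with p h1 h2 hp
    refine ⟨h1 hp, ?_, h2 (h1 hp)⟩
    filter_upwards [isOpen_interior.mem_nhds (h1 hp)] with q hq
    exact ⟨hfin hq, legendre_ne_bot v q⟩
  have hdom' : ∀ᵐ p ∂(volume.restrict P), p ∈ interior P ∧ p ∈ gradDom (legendre v) :=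
    (ae_restrict_iff' hP.measurableSet).2 hdom
  refine ⟨v, ⟨hvconv, 0, fun x => ?_⟩, hdom'.mono fun p hp => hp.2, fun h => ?_⟩
  · rw [add_zero]
    exact le_of_tendsto (hv x) (Eventually.of_forall fun k => hus _ _)
  have hconv : ∀ᵐ p ∂ν, Tendsto (fun k => T (φ k) p) atTop (𝓝 (egrad (legendre v) p)) := by
    filter_upwards [hac.ae_le hdom', ae_all_iff.2 hTmax] with p hp hmax
    refine tendsto_of_subseq_tendsto fun ψ hψ => ?_
    obtain ⟨x₀, hx₀, θ, hθ⟩ := hmaxlim p hp.1 ψ hψ (fun k => T (φ (ψ k)) p) fun k => hmax _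
    refine ⟨θ, ?_⟩
    rw [← eq_egrad_legendre hp.2 (toReal_legendre_le hx₀)]
    exact hθ
  have h1 : Tendsto (fun k => ∫ p, h (T (φ k) p) ∂ν) atTop
      (𝓝 (∫ p, h (egrad (legendre v) p) ∂ν)) :=
    tendsto_integral_of_dominated_convergence (fun _ => ‖h‖)
      (fun k => (h.continuous.measurable.comp (hTm _)).aestronglyMeasurable) (integrable_const _)
      (fun k => Eventually.of_forall fun p => h.norm_coe_le_norm _)
      (hconv.mono fun p hp => (h.continuous.tendsto _).comp hp)
  have h2 : Tendsto (fun k => ∫ x, h (s (φ k) x) ∂μ) atTop (𝓝 (∫ x, h x ∂μ)) := by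
    refine tendsto_integral_of_dominated_convergence (fun _ => ‖h‖)
      (fun k => (h.continuous.measurable.comp (s (φ k)).measurable).aestronglyMeasurable)
      (integrable_const _) (fun k => Eventually.of_forall fun p => h.norm_coe_le_norm _)
      (Eventually.of_forall fun x => (h.continuous.tendsto _).comp ?_)
    exact (SimpleFunc.tendsto_approxOn measurable_id (Set.mem_univ _)
      (by simp)).comp hφ.tendsto_atTop
  exact tendsto_nhds_unique h2 (h1.congr fun k => hint _ h)

end Existence

/-! ### Uniqueness -/

section Uniqueness

variable {n : ℕ} {P : Set (EuclideanSpace ℝ (Fin n))} {u v : EuclideanSpace ℝ (Fin n) → ℝ}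

/-- The set where the transform is finite is convex, so if it has full measure in `P` it contains
the whole interior of `P`. -/
theorem interior_subset_legendre_ne_top
    (hu : ∀ᵐ p ∂(volume.restrict P), p ∈ gradDom (legendre u)) :
    interior P ⊆ {p | legendre u p ≠ ⊤} := by
  have hu' : ∀ᵐ p ∂((volume : Measure (EuclideanSpace ℝ (Fin n))).restrict (interior P)),
      p ∈ gradDom (legendre u) := ae_restrict_of_ae_restrict_of_subset interior_subset hu
  rw [ae_restrict_iff' isOpen_interior.measurableSet] at hu'
  have hfreq : ∀ q ∈ interior P, ∃ᶠ p in 𝓝 q, p ∈ gradDom (legendre u) := fun q hq =>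
    ((mem_closure_iff_frequently.1 (Measure.dense_of_ae hu' q)).and_eventually
      (isOpen_interior.mem_nhds hq)).mono fun p hp => hp.1 hp.2
  intro q hq
  have hsub : interior P ⊆ closure {p | legendre u p ≠ ⊤} := fun r hr =>
    mem_closure_iff_frequently.2 ((hfreq r hr).mono fun p hp => hp.1.self_of_nhds.1)
  obtain ⟨p, hp⟩ := (hfreq q hq).exists
  have hne : (interior {p | legendre u p ≠ ⊤}).Nonempty :=
    ⟨p, mem_interior_iff_mem_nhds.2 (hp.1.mono fun _ h => h.1)⟩
  have h := interior_mono hsub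
  rw [interior_interior,
    (convexOn_toReal_legendre u).1.interior_closure_eq_interior_of_nonempty_interior hne] at h
  exact interior_subset (h hq)

/-- If `∇u*` and `∇v*` transport `ν` to the same measure, they agree almost everywhere. With
`h = v - u`, Fenchel's inequality gives `h(∇v*) ≤ u* - v* ≤ h(∇u*)`; the outer terms have the same law,
so both inequalities are equalities, and then `∇u* p` attains the supremum defining `v* p`. -/
theorem egrad_legendre_ae_eq (hu : ConvexOn ℝ Set.univ u) (hv : ConvexOn ℝ Set.univ v)
    {ν : Measure (EuclideanSpace ℝ (Fin n))} [IsFiniteMeasure ν]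
    (hud : ∀ᵐ p ∂ν, p ∈ gradDom (legendre u)) (hvd : ∀ᵐ p ∂ν, p ∈ gradDom (legendre v))
    (hint : ∀ h : EuclideanSpace ℝ (Fin n) →ᵇ ℝ,
      ∫ p, h (egrad (legendre u) p) ∂ν = ∫ p, h (egrad (legendre v) p) ∂ν) :
    ∀ᵐ p ∂ν, egrad (legendre u) p = egrad (legendre v) p := by
  -- `v - u` may be unbounded; composing with `arctan` gives a test function.
  let θ : EuclideanSpace ℝ (Fin n) →ᵇ ℝ := BoundedContinuousFunction.ofNormedAddCommGroup
    (fun x => Real.arctan (v x - u x))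
    (Real.continuous_arctan.comp
      (hv.locallyLipschitz.continuous.sub hu.locallyLipschitz.continuous))
    (Real.pi / 2) fun x => by
      rw [Real.norm_eq_abs]
      exact abs_le.2 ⟨(Real.neg_pi_div_two_lt_arctan _).le, (Real.arctan_lt_pi_div_two _).le⟩
  have hθ : ∀ x, θ x = Real.arctan (v x - u x) := fun _ => rfl
  have hsand : ∀ᵐ p ∂ν,
      v (egrad (legendre v) p) - u (egrad (legendre v) p) ≤
        (legendre u p).toReal - (legendre v p).toReal ∧
      (legendre u p).toReal - (legendre v p).toReal ≤
        v (egrad (legendre u) p) - u (egrad (legendre u) p) := by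
    filter_upwards [hud, hvd] with p hpu hpv
    have h1 := apply_egrad_legendre hu hpu
    have h2 := apply_egrad_legendre hv hpv
    have h3 := inner_sub_le_toReal_legendre (u := v) hpv.1.self_of_nhds.1 (egrad (legendre u) p)
    have h4 := inner_sub_le_toReal_legendre (u := u) hpu.1.self_of_nhds.1 (egrad (legendre v) p)
    constructor <;> linarith
  have hintegrable : ∀ w : EuclideanSpace ℝ (Fin n) → EReal,
      Integrable (fun p => θ (egrad w p)) ν := fun w =>
    Integrable.of_bound (θ.continuous.measurable.comp (measurable_gradient _)).aestronglyMeasurable _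
      (Eventually.of_forall fun p => θ.norm_coe_le_norm _)
  have hle : (fun p => θ (egrad (legendre v) p)) ≤ᵐ[ν] fun p => θ (egrad (legendre u) p) := by
    filter_upwards [hsand] with p hp
    exact Real.arctan_strictMono.monotone (hp.1.trans hp.2)
  have heq := (integral_eq_iff_of_ae_le (hintegrable _) (hintegrable _) hle).1 (hint θ).symm
  filter_upwards [hsand, heq, hud, hvd] with p hp hpe hpu hpv
  refine eq_egrad_legendre hpv ?_
  have h1 := Real.arctan_injective hpe
  have h2 := apply_egrad_legendre hu hpu
  linarith [hp.1, hp.2]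

/-- A function in the class of `P` is recovered from its transform on the interior of `P`. -/
theorem add_le_of_legendre_le_on_interior (hP : IsCompact P) (hPc : Convex ℝ P)
    (hne : (interior P).Nonempty) (hu : u ∈ ConvexClass P)
    (hud : interior P ⊆ {p | legendre u p ≠ ⊤}) (hvd : interior P ⊆ {p | legendre v p ≠ ⊤}) {c : ℝ}
    (hc : ∀ p ∈ interior P, (legendre v p).toReal ≤ (legendre u p).toReal - c)
    (x : EuclideanSpace ℝ (Fin n)) : u x + c ≤ v x := by
  obtain ⟨hconv, C, hC⟩ := hu
  obtain ⟨p₀, hp₀⟩ := hne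
  suffices u x ≤ v x - c by linarith
  refine le_of_forall_lt fun a ha => ?_
  obtain ⟨b, hab, hb⟩ := exists_between ha
  obtain ⟨q, d, hq, hqx⟩ := exists_inner_add_le_of_lt hconv hconv.locallyLipschitz.continuous hb
  have hle : ∀ y, inner ℝ y q - u y ≤ -d := fun y => by linarith [hq y]
  have hqtop := legendre_ne_top_of_le hle
  have hqP : q ∈ P := mem_of_legendre_ne_top hP hPc ⟨p₀, interior_subset hp₀⟩ hC hqtop
  -- Move from `q`, which may lie on the boundary of `P`, slightly towards the interior point `p₀`.
  have key : ∀ t : ℝ, 0 < t → t < 1 →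
      (1 - t) * (inner ℝ x q + d) + t * (inner ℝ x p₀ - (legendre u p₀).toReal) ≤ v x - c := by
    intro t ht0 ht1
    have hmem : (1 - t) • q + t • p₀ ∈ interior P :=
      hPc.combo_self_interior_mem_interior hqP hp₀ (by linarith) ht0 (by ring)
    have h1 := (convexOn_toReal_legendre u).2 hqtop (hud hp₀) (by linarith : 0 ≤ 1 - t) ht0.le
      (by ring)
    have h2 := hc _ hmem
    have h3 := inner_sub_le_toReal_legendre (hvd hmem) x
    have h4 := mul_le_mul_of_nonneg_left (toReal_legendre_le hle) (by linarith : 0 ≤ 1 - t)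
    rw [inner_add_right, inner_smul_right, inner_smul_right] at h3
    simp only [smul_eq_mul] at h1
    linarith
  have hcont : Continuous fun t : ℝ =>
      (1 - t) * (inner ℝ x q + d) + t * (inner ℝ x p₀ - (legendre u p₀).toReal) := by fun_prop
  have hlim := (hcont.tendsto 0).mono_left (nhdsWithin_le_nhds (s := Set.Ioi 0))
  have := le_of_tendsto hlim (by
    filter_upwards [Ioo_mem_nhdsGT (zero_lt_one' ℝ)] with t ht using key t ht.1 ht.2)
  simp only [sub_zero, one_mul, zero_mul, add_zero, hqx] at this
  linarith

/-- Uniqueness of the potential up to an additive constant. -/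
theorem exists_eq_add_const_of_integral_eq (hP : IsCompact P) (hPc : Convex ℝ P)
    (hne : (interior P).Nonempty) {ν : Measure (EuclideanSpace ℝ (Fin n))} [IsFiniteMeasure ν]
    (hac : ν ≪ volume.restrict P) (hca : volume.restrict P ≪ ν)
    (hu : u ∈ ConvexClass P) (hv : v ∈ ConvexClass P)
    (hud : ∀ᵐ p ∂(volume.restrict P), p ∈ gradDom (legendre u))
    (hvd : ∀ᵐ p ∂(volume.restrict P), p ∈ gradDom (legendre v))
    (hint : ∀ h : EuclideanSpace ℝ (Fin n) →ᵇ ℝ,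
      ∫ p, h (egrad (legendre u) p) ∂ν = ∫ p, h (egrad (legendre v) p) ∂ν) :
    ∃ c : ℝ, ∀ x, v x = u x + c := by
  have hgrad := hca.ae_le
    (egrad_legendre_ae_eq hu.1 hv.1 (hac.ae_le hud) (hac.ae_le hvd) hint)
  have hus := interior_subset_legendre_ne_top hud
  have hvs := interior_subset_legendre_ne_top hvd
  have hT : ∀ᵐ p ∂(volume : Measure (EuclideanSpace ℝ (Fin n))), p ∈ interior P →
      HasGradientAt (fun q => (legendre u q).toReal) (egrad (legendre u) p) p ∧
      HasGradientAt (fun q => (legendre v q).toReal) (egrad (legendre u) p) p := by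
    filter_upwards [(ae_restrict_iff' hP.measurableSet).1 hud,
      (ae_restrict_iff' hP.measurableSet).1 hvd,
      (ae_restrict_iff' hP.measurableSet).1 hgrad] with p h1 h2 h3 hp
    have hpP := interior_subset hp
    refine ⟨hasGradientAt_egrad (h1 hpP), ?_⟩
    rw [h3 hpP]
    exact hasGradientAt_egrad (h2 hpP)
  obtain ⟨p₀, hp₀⟩ := hne
  have hconst := fun p (hp : p ∈ interior P) => sub_eq_sub_of_ae_hasGradientAt volume isOpen_interior
    ((convexOn_toReal_legendre u).subset hus hPc.interior)
    ((convexOn_toReal_legendre v).subset hvs hPc.interior) hT hp₀ hp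
  refine ⟨(legendre u p₀).toReal - (legendre v p₀).toReal, fun x => le_antisymm ?_ ?_⟩
  · have := add_le_of_legendre_le_on_interior hP hPc ⟨p₀, hp₀⟩ hv hvs hus
      (c := (legendre v p₀).toReal - (legendre u p₀).toReal)
      (fun p hp => by linarith [hconst p hp]) x
    linarith
  · exact add_le_of_legendre_le_on_interior hP hPc ⟨p₀, hp₀⟩ hu hus hvs
      (fun p hp => by linarith [hconst p hp]) x

end Uniqueness

/-! ### The measure with density `g` -/

section Density

/-- The probability measure `g(p) dp` on `P`. -/
noncomputable def densityMeasure {n : ℕ} (P : Set (EuclideanSpace ℝ (Fin n)))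
    (g : EuclideanSpace ℝ (Fin n) → ℝ) : Measure (EuclideanSpace ℝ (Fin n)) :=
  (volume.restrict P).withDensity fun p => ENNReal.ofReal (g p)

variable {n : ℕ} {P : Set (EuclideanSpace ℝ (Fin n))} {g : EuclideanSpace ℝ (Fin n) → ℝ}

theorem integral_densityMeasure (hg : AEMeasurable g (volume.restrict P))
    (hpos : ∀ᵐ p ∂(volume.restrict P), 0 < g p) (F : EuclideanSpace ℝ (Fin n) → ℝ) :
    ∫ p, F p ∂(densityMeasure P g) = ∫ p in P, F p * g p := by
  unfold densityMeasure
  rw [integral_withDensity_eq_integral_toReal_smul₀ hg.ennreal_ofReal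
    (Eventually.of_forall fun _ => ENNReal.ofReal_lt_top)]
  refine integral_congr_ae ?_
  filter_upwards [hpos] with p hp
  rw [ENNReal.toReal_ofReal hp.le, smul_eq_mul, mul_comm]

theorem isProbabilityMeasure_densityMeasure (hpos : ∀ᵐ p ∂(volume.restrict P), 0 < g p)
    (hprob : ∫ p in P, g p = 1) : IsProbabilityMeasure (densityMeasure P g) := by
  constructor
  have hint : Integrable g (volume.restrict P) := by
    by_contra h
    rw [integral_undef h] at hprob
    exact zero_ne_one hprob
  rw [densityMeasure, withDensity_apply _ MeasurableSet.univ, Measure.restrict_univ,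
    ← ofReal_integral_eq_lintegral_ofReal hint (hpos.mono fun p hp => hp.le), hprob,
    ENNReal.ofReal_one]

theorem absolutelyContinuous_densityMeasure (hg : AEMeasurable g (volume.restrict P))
    (hpos : ∀ᵐ p ∂(volume.restrict P), 0 < g p) : volume.restrict P ≪ densityMeasure P g :=
  withDensity_absolutelyContinuous' hg.ennreal_ofReal
    (hpos.mono fun _ hp => (ENNReal.ofReal_pos.2 hp).ne')

theorem smul_restrict_le_densityMeasure {c : ℝ}
    (hc : ∀ᵐ p ∂(volume.restrict P), c < g p) :
    ENNReal.ofReal c • volume.restrict P ≤ densityMeasure P g := by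
  rw [densityMeasure, ← withDensity_const]
  exact withDensity_mono (hc.mono fun p hp => ENNReal.ofReal_le_ofReal hp.le)

end Density

end TransportedMA

theorem mainTheorem2 (n : ℕ) (P : Set (EuclideanSpace ℝ (Fin n)))
    (hP : TransportedMA.IsPolytope P)
    (g : EuclideanSpace ℝ (Fin n) → ℝ)
    (hg : AEMeasurable g (volume.restrict P))
    (hbd : ∃ C : ℝ, 0 < C ∧ ∀ᵐ p ∂(volume.restrict P), 1 / C < g p ∧ g p < C)
    (hprob : ∫ p in P, g p = 1)
    (μ : Measure (EuclideanSpace ℝ (Fin n))) [IsProbabilityMeasure μ] :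
    (∃ u : EuclideanSpace ℝ (Fin n) → ℝ, TransportedMA.IsSolution P g μ u) ∧
      ∀ u v : EuclideanSpace ℝ (Fin n) → ℝ,
        TransportedMA.IsSolution P g μ u → TransportedMA.IsSolution P g μ v →
          ∃ c : ℝ, ∀ x, v x = u x + c := by
  obtain ⟨s, hs, rfl⟩ := hP
  set P := convexHull ℝ s
  have hPcpt : IsCompact P := hs.isCompact_convexHull (𝕜 := ℝ)
  have hPc : Convex ℝ P := convex_convexHull ℝ s
  obtain ⟨C, hC, hCg⟩ := hbd
  have hC' : 0 < 1 / C := by positivity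
  have hpos : ∀ᵐ p ∂(volume.restrict P), 0 < g p := hCg.mono fun p hp => hC'.trans hp.1
  have := TransportedMA.isProbabilityMeasure_densityMeasure hpos hprob
  have hac : TransportedMA.densityMeasure P g ≪ volume.restrict P :=
    withDensity_absolutelyContinuous _ _
  have hint : (interior P).Nonempty := by
    rw [Set.nonempty_iff_ne_empty]
    intro h
    have h0 : volume P = 0 := by
      refine measure_mono_null (fun p hp => ?_) (hPc.addHaar_frontier volume)
      exact ⟨subset_closure hp, by simp [h]⟩
    rw [Measure.restrict_eq_zero.2 h0, integral_zero_measure] at hprob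
    exact zero_ne_one hprob
  refine ⟨?_, fun u v hu hv => ?_⟩
  · obtain ⟨u, hu, hud, hui⟩ := TransportedMA.exists_transport hPcpt hPc
      (hint.mono interior_subset) hac (ENNReal.ofReal_pos.2 hC').ne'
      (TransportedMA.smul_restrict_le_densityMeasure (hCg.mono fun p hp => hp.1)) μ
    exact ⟨u, hu, hud, fun f => (hui f).trans (TransportedMA.integral_densityMeasure hg hpos _)⟩
  · refine TransportedMA.exists_eq_add_const_of_integral_eq hPcpt hPc hint hac
      (TransportedMA.absolutelyContinuous_densityMeasure hg hpos) hu.mem_class hv.mem_class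
      hu.ae_mem_gradDom hv.ae_mem_gradDom fun f => ?_
    rw [TransportedMA.integral_densityMeasure hg hpos, TransportedMA.integral_densityMeasure hg hpos,
      ← hu.integral_eq f, ← hv.integral_eq f]
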